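/- **Setting.** Let $k$ be an algebraically closed field of characteristic $p>2$, let $X=\mathbb{P}^1_k$ with standard parameter $t$ and $D=\partial/\partial t$, and let $x_1,\dots,x_r\in X$ be $r\ge 3$ distinct closed points (the marked points) with $x_r=\infty$. A flat bundle on $X$ is a vector bundle $\mathcal{E}$ with a connection $\nabla:\mathcal{E}\to\mathcal{E}\otimes\Omega_{X/k}(\sum x_i)$. Its monodromy operator $\mu_i$ at $x_i$ is the endomorphism of the fibre of $\mathcal{E}$ at $x_i$ induced by $\nabla(s\,\partial/\partial s)$, where $s$ is a local parameter at $x_i$; the eigenvalues of $\mu_i$ are the local exponents of $\mathcal{E}$ at $x_i$. Let $(\mathcal{E},\nabla)$ be a flat bundle of rank two on $X$ which is * *indigenous*: every $\mu_i$ is nonzero, and there is a line subbundle $F^1\mathcal{E}\subset\mathcal{E}$, with quotient a line bundle (the Hodge filtration, which is unique), whose Kodaira–Spencer map $F^1\mathcal{E}\to(\mathcal{E}/F^1\mathcal{E})\otimes\Omega_{X/k}(\sum x_i)$ is an isomorphism; * *active and nilpotent*: the $p$-curvature $\delta\mapsto\nabla(\delta)^p-\nabla(\delta^p)$ ($\delta$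 a rational vector field) is not zero, and all its values are nilpotent; * *normalized*: there is a surjective horizontal homomorphism $\gamma:\mathcal{E}\to\mathcal{O}_X$, where $\mathcal{O}_X$ has the connection $d$. Fix such a $\gamma$. Let $e_0$ be the rational section of $F^1\mathcal{E}$ with $\gamma(e_0)=1$. The *supersingular points* are the points where $e_0$ has a simple pole; let $d$ be their number. Let $e_1$ be an everywhere invertible section of $F^1\mathcal{E}$ on $\mathbb{A}^1_k=X\setminus\{\infty\}$ and put $e_2=\nabla(D)(e_1)$. Write $\nabla(D)(e_2)=-p_2e_1-p_1e_2$ with $p_1,p_2\in k(t)$; the differential operator associated to $(\mathcal{E},\nabla)$ is $L(u)=u''+p_1u'+p_2u$. **Proposition.** 1. The equation $L(u)=0$ has a nonzero polynomial solution $u\in k[t]$ all of whose zeros are simple and whose zeros are exactly the supersingular points of $(\mathcal{E},\nabla)$ (in particular, $\infty$ is not supersingular). It is unique up to multiplication by a constant in $k^\times$; more precisely, every nonzero polynomial solution of $L(u)=0$ with only simple zeros is a constant multiple of it. 2. The flat line bundle $\mathrm{Ker}(\gamma)$ has exactly one local exponent $\alpha_r$ at $x_r=\infty$, and $\alpha_r\in\mathbb{F}_p$.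 The operator $L$ has at most a regular singularity at $\infty$, and its local exponents there (the roots in $k$ of the indicial polynomial in the parameter $1/t$, with multiplicity) are $-d+\alpha_r$ and $-d$. -/

import Mathlib

open Polynomial
open scoped OnePoint

noncomputable section

namespace P1Indigenous

/-! ### The projective line over `k`

The closed points of the projective line over the algebraically closed field `k` are the elements
of `OnePoint k`; its function field is `RatFunc k`, with standard parameter `t = RatFunc.X`. -/

section Line

variable {k : Type*} [Field k]

theorem ratFunc_algebraMap_ne {q : k[X]} (hq : q ≠ 0) : algebraMap k[X] (RatFunc k) q ≠ 0 :=
  RatFunc.algebraMap_ne_zero hq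

/-- The quotient rule, on the reduced fraction. -/
def ddtFun (f : RatFunc k) : RatFunc k :=
  (algebraMap k[X] (RatFunc k) (derivative f.num) * algebraMap k[X] (RatFunc k) f.denom
    - algebraMap k[X] (RatFunc k) f.num * algebraMap k[X] (RatFunc k) (derivative f.denom))
    / algebraMap k[X] (RatFunc k) f.denom ^ 2

theorem ddtFun_div (a b : k[X]) (hb : b ≠ 0) :
    ddtFun (algebraMap k[X] (RatFunc k) a / algebraMap k[X] (RatFunc k) b) =
      (algebraMap k[X] (RatFunc k) (derivative a) * algebraMap k[X] (RatFunc k) b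
        - algebraMap k[X] (RatFunc k) a * algebraMap k[X] (RatFunc k) (derivative b))
        / algebraMap k[X] (RatFunc k) b ^ 2 := by
  set f := algebraMap k[X] (RatFunc k) a / algebraMap k[X] (RatFunc k) b with hf
  have hbK := ratFunc_algebraMap_ne hb
  have hdK := ratFunc_algebraMap_ne (RatFunc.denom_ne_zero f)
  have h1 : f.num * b = a * f.denom := by
    apply RatFunc.algebraMap_injective k
    have h2 := RatFunc.num_div_denom f
    rw [hf, div_eq_div_iff (by rw [← hf]; exact hdK) hbK, ← hf] at h2
    rw [map_mul, map_mul]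
    exact h2
  have h2 := congrArg derivative h1
  simp only [derivative_mul] at h2
  have h1K := congrArg (algebraMap k[X] (RatFunc k)) h1
  have h2K := congrArg (algebraMap k[X] (RatFunc k)) h2
  simp only [map_mul, map_add] at h1K h2K
  unfold ddtFun
  rw [div_eq_div_iff (pow_ne_zero 2 hdK) (pow_ne_zero 2 hbK)]
  set P := algebraMap k[X] (RatFunc k) f.num
  set Q := algebraMap k[X] (RatFunc k) f.denom
  set P' := algebraMap k[X] (RatFunc k) (derivative f.num)
  set Q' := algebraMap k[X] (RatFunc k) (derivative f.denom)
  set A := algebraMap k[X] (RatFunc k) a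
  set B := algebraMap k[X] (RatFunc k) b
  set A' := algebraMap k[X] (RatFunc k) (derivative a)
  set B' := algebraMap k[X] (RatFunc k) (derivative b)
  linear_combination (B * Q) * h2K - (B' * Q + Q' * B) * h1K

/-- The derivation `D = ∂/∂t` of `k(t)`. -/
def ddt (k : Type*) [Field k] : Derivation k (RatFunc k) (RatFunc k) :=
  Derivation.mk'
    { toFun := ddtFun
      map_add' := fun f g => by
        obtain ⟨hf, hg⟩ := And.intro (RatFunc.denom_ne_zero f) (RatFunc.denom_ne_zero g)
        have hfK := ratFunc_algebraMap_ne hf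
        have hgK := ratFunc_algebraMap_ne hg
        have h : f + g = algebraMap k[X] (RatFunc k) (f.num * g.denom + f.denom * g.num)
            / algebraMap k[X] (RatFunc k) (f.denom * g.denom) := by
          conv_lhs => rw [← RatFunc.num_div_denom f, ← RatFunc.num_div_denom g]
          rw [div_add_div _ _ hfK hgK]
          simp only [map_add, map_mul]
        rw [h, ddtFun_div _ _ (mul_ne_zero hf hg)]
        unfold ddtFun
        simp only [derivative_mul, map_add, map_mul]
        field_simp
        ring
      map_smul' := fun c f => by
        have hf := RatFunc.denom_ne_zero f
        have hs : ∀ g : RatFunc k, c • g = algebraMap k[X] (RatFunc k) (C c) * g := by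
          intro g
          rw [RatFunc.algebraMap_C, ← RatFunc.algebraMap_eq_C, Algebra.smul_def]
        have h : c • f = algebraMap k[X] (RatFunc k) (C c * f.num)
            / algebraMap k[X] (RatFunc k) f.denom := by
          conv_lhs => rw [← RatFunc.num_div_denom f]
          rw [hs, map_mul, mul_div_assoc]
        rw [RingHom.id_apply, h, ddtFun_div _ _ hf, hs]
        unfold ddtFun
        simp only [derivative_C_mul, map_mul]
        ring }
    (fun f g => by
        obtain ⟨hf, hg⟩ := And.intro (RatFunc.denom_ne_zero f) (RatFunc.denom_ne_zero g)
        have hfK := ratFunc_algebraMap_ne hf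
        have hgK := ratFunc_algebraMap_ne hg
        have h : f * g = algebraMap k[X] (RatFunc k) (f.num * g.num)
            / algebraMap k[X] (RatFunc k) (f.denom * g.denom) := by
          conv_lhs => rw [← RatFunc.num_div_denom f, ← RatFunc.num_div_denom g]
          rw [div_mul_div_comm]
          simp only [map_mul]
        change ddtFun (f * g) = f * ddtFun g + g * ddtFun f
        rw [h, ddtFun_div _ _ (mul_ne_zero hf hg)]
        conv_rhs =>
          rw [← RatFunc.num_div_denom f, ← RatFunc.num_div_denom g]
          rw [ddtFun_div _ _ hf, ddtFun_div _ _ hg]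
        simp only [derivative_mul, map_add, map_mul]
        field_simp
        ring)

theorem ddt_algebraMap (a : k[X]) :
    ddt k (algebraMap k[X] (RatFunc k) a) = algebraMap k[X] (RatFunc k) (derivative a) := by
  have h := ddtFun_div a 1 one_ne_zero
  simp only [map_one, div_one, derivative_one, map_zero, mul_one, mul_zero, sub_zero, one_pow] at h
  exact h

theorem ddt_X : ddt k (RatFunc.X : RatFunc k) = 1 := by
  rw [← RatFunc.algebraMap_X, ddt_algebraMap]
  simp

/-- The standard local parameter at a point: `t - a` at `a`, and `1 / t` at `∞`. -/
def localParam : OnePoint k → RatFunc k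
  | (a : k) => RatFunc.X - RatFunc.C a
  | ∞ => RatFunc.X⁻¹

/-- The derivation `∂/∂s`, where `s` is the standard local parameter: `∂/∂t` at `a`, and
`-t² ∂/∂t` at `∞`. -/
def localDer : OnePoint k → Derivation k (RatFunc k) (RatFunc k)
  | (_ : k) => ddt k
  | ∞ => -((RatFunc.X ^ 2 : RatFunc k) • ddt k)

theorem localDer_localParam (x : OnePoint k) : localDer x (localParam x) = 1 := by
  match x with
  | (a : k) =>
    change ddt k (RatFunc.X - RatFunc.C a) = 1
    have h : ddt k (RatFunc.C a) = 0 := (ddt k).map_algebraMap a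
    rw [map_sub, ddt_X, h, sub_zero]
  | ∞ =>
    change (-((RatFunc.X ^ 2 : RatFunc k) • ddt k)) (RatFunc.X⁻¹) = 1
    have hX : (RatFunc.X : RatFunc k) ≠ 0 := RatFunc.X_ne_zero
    rw [Derivation.neg_apply, Derivation.smul_apply, Derivation.leibniz_inv, ddt_X]
    simp only [smul_eq_mul]
    field_simp

theorem localParam_transcendental (x : OnePoint k) : Transcendental k (localParam x) := by
  match x with
  | (a : k) =>
    intro h
    apply RatFunc.transcendental_X (K := k)
    have h2 : (RatFunc.X : RatFunc k) = (RatFunc.X - RatFunc.C a) + algebraMap k (RatFunc k) a := by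
      rw [RatFunc.algebraMap_eq_C]; ring
    rw [h2]
    exact h.add (isAlgebraic_algebraMap a)
  | ∞ =>
    intro h
    apply RatFunc.transcendental_X (K := k)
    have := h.inv
    change IsAlgebraic k ((RatFunc.X : RatFunc k)⁻¹)⁻¹ at this
    rwa [inv_inv] at this

theorem aeval_localParam_ne_zero (x : OnePoint k) {q : k[X]} (hq : q ≠ 0) :
    aeval (localParam x) q ≠ 0 :=
  fun h => hq ((transcendental_iff.mp (localParam_transcendental x)) q h)

/-- The local ring of the projective line at `x`: with `s` the standard local parameter at `x`, it
is `k[s]` localized at `s = 0`, that is, the ring of the fractions `a(s) / b(s)` with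
`b(0) ≠ 0`. -/
def localRing (x : OnePoint k) : Subalgebra k (RatFunc k) where
  carrier := {f | ∃ a b : k[X], b.eval 0 ≠ 0 ∧
    f = aeval (localParam x) a / aeval (localParam x) b}
  mul_mem' := by
    rintro f g ⟨a, b, hb, rfl⟩ ⟨c, d, hd, rfl⟩
    refine ⟨a * c, b * d, ?_, ?_⟩
    · rw [eval_mul]; exact mul_ne_zero hb hd
    · rw [map_mul, map_mul, div_mul_div_comm]
  add_mem' := by
    rintro f g ⟨a, b, hb, rfl⟩ ⟨c, d, hd, rfl⟩
    refine ⟨a * d + b * c, b * d, ?_, ?_⟩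
    · rw [eval_mul]; exact mul_ne_zero hb hd
    · rw [map_add, map_mul, map_mul, map_mul, div_add_div]
      · exact aeval_localParam_ne_zero x (by rintro rfl; simp at hb)
      · exact aeval_localParam_ne_zero x (by rintro rfl; simp at hd)
  algebraMap_mem' := fun c => ⟨C c, 1, by simp, by simp⟩

theorem localParam_mem (x : OnePoint k) : localParam x ∈ localRing x :=
  ⟨X, 1, by simp, by simp⟩

/-- The local parameter as an element of the local ring. -/
def localParamO (x : OnePoint k) : localRing x := ⟨localParam x, localParam_mem x⟩

/-- The maximal ideal of the local ring at `x`. -/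
def maxIdeal (x : OnePoint k) : Ideal (localRing x) := Ideal.span {localParamO x}

/-- `f` is regular at `x` and takes the value `c` there. -/
def HasValueAt (x : OnePoint k) (f : RatFunc k) (c : k) : Prop :=
  ∃ g ∈ localRing x, f = algebraMap k (RatFunc k) c + localParam x * g

/-- The derivation `s ∂/∂s`, where `s` is the standard local parameter at `x`. -/
def eulerDer (x : OnePoint k) : Derivation k (RatFunc k) (RatFunc k) := localParam x • localDer x

open Classical in
/-- A generator at `x` of the sheaf of vector fields which vanish at the marked points. -/
def logDer (S : Finset (OnePoint k)) (x : OnePoint k) : Derivation k (RatFunc k) (RatFunc k) :=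
  if x ∈ S then eulerDer x else localDer x

/-- In characteristic `p`, the `p`-fold iterate `δ ∘ ⋯ ∘ δ` of a derivation is a derivation. -/
def derivPow (p : ℕ) [Fact p.Prime] [CharP k p] (δ : Derivation k (RatFunc k) (RatFunc k)) :
    Derivation k (RatFunc k) (RatFunc k) :=
  Derivation.mk' ((δ : RatFunc k →ₗ[k] RatFunc k) ^ p) (fun f g => by
    let M := Module.End k (RatFunc k)
    let d : M := (δ : RatFunc k →ₗ[k] RatFunc k)
    have : CharP (Module.End k M) p := by
      have : Nontrivial M := inferInstance
      exact charP_of_injective_algebraMap (algebraMap k (Module.End k M)).injective p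
    have hcomm : Commute (LinearMap.mulLeft k d) (LinearMap.mulRight k d) :=
      LinearMap.commute_mulLeft_right (R := k) d d
    have hp := sub_pow_char_of_commute (p := p) hcomm
    have hone : ∀ h : RatFunc k, (LinearMap.mulLeft k d - LinearMap.mulRight k d)
        (LinearMap.mulLeft k h) = LinearMap.mulLeft k (d h) := by
      intro h
      ext y
      change δ (h * y) - h * δ y = δ h * y
      rw [Derivation.leibniz]
      simp only [smul_eq_mul]
      ring
    have hit : ∀ n : ℕ, ((LinearMap.mulLeft k d - LinearMap.mulRight k d) ^ n)
        (LinearMap.mulLeft k f) = LinearMap.mulLeft k ((d ^ n) f) := by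
      intro n
      induction n with
      | zero => rfl
      | succ n ih =>
        rw [pow_succ', Module.End.mul_apply, ih, hone, pow_succ', Module.End.mul_apply]
    have h1 := hit p
    rw [hp, LinearMap.sub_apply, LinearMap.pow_mulLeft, LinearMap.pow_mulRight] at h1
    have h2 := congrArg (fun e : M => e g) h1
    change (d ^ p) (f * g) - f * (d ^ p) g = (d ^ p) f * g at h2
    change (d ^ p) (f * g) = f * (d ^ p) g + g * (d ^ p) f
    linear_combination h2)

end Line

/-! ### Flat vector bundles with logarithmic poles -/

section Bundle

variable {k : Type*} [Field k]

/-- A sheaf of lattices on the projective line with generic fibre the `k(t)`-vector space `V`,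
given by its stalks, together with a connection with at most simple poles in the marked points.

The sections over an open set `U` are the elements of `V` which lie in all stalks at points of `U`.
The connection is given on rational sections, as `δ ↦ ∇(δ)`; that it maps into the sheaf twisted by
the differential forms with at most simple poles in the marked points means that `∇(D)` preserves
the stalk at `x`, if `D` generates the logarithmic vector fields at `x`. -/
structure LogConnection (S : Finset (OnePoint k)) (V : Type*) [AddCommGroup V]
    [Module (RatFunc k) V] [Module k V] [IsScalarTower k (RatFunc k) V] where
  /-- the stalk at a point -/
  stalk : ∀ x : OnePoint k, Submodule (localRing x) V
  /-- the operators `∇(δ)` on rational sections -/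
  nabla : Derivation k (RatFunc k) (RatFunc k) →ₗ[RatFunc k] (V →ₗ[k] V)
  leibniz : ∀ (δ : Derivation k (RatFunc k) (RatFunc k)) (f : RatFunc k) (v : V),
    nabla δ (f • v) = δ f • v + f • nabla δ v
  log : ∀ (x : OnePoint k), ∀ v ∈ stalk x, nabla (logDer S x) v ∈ stalk x

namespace LogConnection

variable {S : Finset (OnePoint k)} {V : Type*} [AddCommGroup V]
  [Module (RatFunc k) V] [Module k V] [IsScalarTower k (RatFunc k) V] (E : LogConnection S V)

/-- The stalks are the stalks of a vector bundle with generic fibre `V`: each is a lattice in `V`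
(so free, the local rings being discrete valuation rings), and almost all of them are generated by
one and the same basis of `V`. -/
structure IsVectorBundle : Prop where
  fg : ∀ x, (E.stalk x).FG
  spans : ∀ x, Submodule.span (RatFunc k) (E.stalk x : Set V) = ⊤
  coherent : ∃ (n : ℕ) (b : Module.Basis (Fin n) (RatFunc k) V),
    {x | E.stalk x ≠ Submodule.span (localRing x) (Set.range b)}.Finite

theorem euler_mem (x : OnePoint k) (v : V) (hv : v ∈ E.stalk x) :
    E.nabla (eulerDer x) v ∈ E.stalk x := by
  have h := E.log x v hv
  by_cases hx : x ∈ S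
  · rwa [logDer, if_pos hx] at h
  · rw [logDer, if_neg hx] at h
    have h2 := (E.stalk x).smul_mem (localParamO x) h
    have h3 : E.nabla (eulerDer x) v = localParamO x • E.nabla (localDer x) v := by
      rw [eulerDer, map_smul]; rfl
    rwa [h3]

/-- `∇(s ∂/∂s)` on the stalk at `x`, where `s` is the standard local parameter. -/
def eulerStalk (x : OnePoint k) : E.stalk x →ₗ[k] E.stalk x where
  toFun v := ⟨E.nabla (eulerDer x) v, E.euler_mem x v v.2⟩
  map_add' v w := by ext; simp
  map_smul' c v := by
    ext
    exact (E.nabla (eulerDer x)).map_smul c (v : V)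

/-- The submodule `𝔪 E_x` of the stalk `E_x`. -/
def maxStalk (x : OnePoint k) : Submodule k (E.stalk x) :=
  (maxIdeal x • (⊤ : Submodule (localRing x) (E.stalk x))).restrictScalars k

theorem maxStalk_le (x : OnePoint k) : E.maxStalk x ≤ (E.maxStalk x).comap (E.eulerStalk x) := by
  intro v hv
  have key : ∀ w : E.stalk x, w ∈ E.maxStalk x ↔ ∃ w', w = localParamO x • w' := by
    intro w
    unfold maxStalk maxIdeal
    rw [Submodule.restrictScalars_mem, Submodule.ideal_span_singleton_smul,
      Submodule.mem_smul_pointwise_iff_exists]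
    constructor
    · rintro ⟨w', -, h⟩; exact ⟨w', h.symm⟩
    · rintro ⟨w', h⟩; exact ⟨w', trivial, h.symm⟩
  rw [key] at hv
  obtain ⟨w, rfl⟩ := hv
  rw [Submodule.mem_comap, key]
  refine ⟨w + E.eulerStalk x w, ?_⟩
  ext
  change E.nabla (eulerDer x) (localParam x • (w : V)) =
    localParam x • ((w : V) + E.nabla (eulerDer x) w)
  rw [E.leibniz, smul_add]
  congr 2
  rw [eulerDer, Derivation.smul_apply, localDer_localParam, smul_eq_mul, mul_one]

/-- The fibre `E_x / 𝔪 E_x` at `x`. -/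
abbrev Fiber (x : OnePoint k) : Type _ := E.stalk x ⧸ E.maxStalk x

/-- The monodromy operator at `x`: the endomorphism of the fibre induced by `∇(s ∂/∂s)`. -/
def monodromy (x : OnePoint k) : Module.End k (E.Fiber x) :=
  (E.maxStalk x).mapQ (E.maxStalk x) (E.eulerStalk x) (E.maxStalk_le x)

/-- The local exponents at `x` are the eigenvalues of the monodromy operator. -/
def IsLocalExponent (x : OnePoint k) (α : k) : Prop := (E.monodromy x).HasEigenvalue α

/-- The saturated subsheaf with generic fibre a horizontal subspace `W`, with the induced
connection. -/
def restrict (W : Submodule (RatFunc k) V) (hW : ∀ δ, ∀ v ∈ W, E.nabla δ v ∈ W) :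
    LogConnection S W where
  stalk x := (E.stalk x).comap (W.subtype.restrictScalars (localRing x))
  nabla :=
    { toFun := fun δ =>
        { toFun := fun v => ⟨E.nabla δ v, hW δ v v.2⟩
          map_add' := fun v w => by ext; simp
          map_smul' := fun c v => by ext; exact (E.nabla δ).map_smul c (v : V) }
      map_add' := fun δ ε => by ext; simp
      map_smul' := fun f δ => by ext; simp }
  leibniz δ f v := by ext; exact E.leibniz δ f v
  log x v hv := E.log x v hv

/-! #### Filtrations and indigenous bundles

A line subbundle whose quotient is a line bundle is the same as its generic fibre `F`, a line in
`V`: its stalks are the intersections of `F` with the stalks of the bundle. -/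

/-- The stalk at `x` of the saturated subsheaf with generic fibre `F`. -/
def subStalk (F : Submodule (RatFunc k) V) (x : OnePoint k) :
    Submodule (localRing x) (E.stalk x) :=
  (F.restrictScalars (localRing x)).comap (E.stalk x).subtype

/-- The Kodaira-Spencer map of the filtration `F` on the stalks at `x`, in terms of the generator
`D` of the logarithmic vector fields at `x`: it sends `e` to the class of `∇(D) e`. -/
def kodairaSpencer (F : Submodule (RatFunc k) V) (x : OnePoint k) :
    E.subStalk F x → E.stalk x ⧸ E.subStalk F x :=
  fun e => Submodule.Quotient.mk ⟨E.nabla (logDer S x) ((e : E.stalk x) : V),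
    E.log x _ (e : E.stalk x).2⟩

/-- `F` is the generic fibre of a Hodge filtration: a line subbundle whose Kodaira-Spencer map is an
isomorphism. -/
structure IsHodgeFiltration (F : Submodule (RatFunc k) V) : Prop where
  rank_one : Module.finrank (RatFunc k) F = 1
  bijective : ∀ x, Function.Bijective (E.kodairaSpencer F x)

/-- Indigenous bundles. -/
structure IsIndigenous : Prop where
  bundle : E.IsVectorBundle
  rank_two : Module.finrank (RatFunc k) V = 2
  hodge : ∃ F, E.IsHodgeFiltration F
  nontrivial : ∀ x ∈ S, E.monodromy x ≠ 0

/-! #### The `p`-curvature -/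

/-- The `p`-curvature `∇(δ)^p - ∇(δ^p)`. -/
def pCurvature (p : ℕ) [Fact p.Prime] [CharP k p] (δ : Derivation k (RatFunc k) (RatFunc k)) :
    Module.End k V :=
  (E.nabla δ : Module.End k V) ^ p - E.nabla (derivPow p δ)

/-- The `p`-curvature is not zero. -/
def IsActive (p : ℕ) [Fact p.Prime] [CharP k p] : Prop := ∃ δ, E.pCurvature p δ ≠ 0

/-- The `p`-curvature is nilpotent. -/
def IsNilpotentCurv (p : ℕ) [Fact p.Prime] [CharP k p] : Prop :=
  ∀ δ, IsNilpotent (E.pCurvature p δ)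

/-! #### Normalized bundles and supersingular points -/

/-- `γ` is a horizontal surjective homomorphism from the bundle to the structure sheaf with the
connection `d`. A bundle with such a `γ` is called normalized. -/
structure IsNormalization (γ : V →ₗ[RatFunc k] RatFunc k) : Prop where
  horizontal : ∀ δ v, γ (E.nabla δ v) = δ (γ v)
  surjective : ∀ x, γ '' (E.stalk x : Set V) = (localRing x : Set (RatFunc k))

variable {E}

theorem IsNormalization.ker_horizontal {γ : V →ₗ[RatFunc k] RatFunc k}
    (hγ : E.IsNormalization γ) (δ : Derivation k (RatFunc k) (RatFunc k)) :
    ∀ v ∈ LinearMap.ker γ, E.nabla δ v ∈ LinearMap.ker γ := by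
  intro v hv
  rw [LinearMap.mem_ker] at hv ⊢
  rw [hγ.horizontal, hv, map_zero]

/-- The kernel of `γ`, with the induced connection. -/
def IsNormalization.kernel {γ : V →ₗ[RatFunc k] RatFunc k} (hγ : E.IsNormalization γ) :
    LogConnection S (LinearMap.ker γ) :=
  E.restrict (LinearMap.ker γ) hγ.ker_horizontal

variable (E)

/-- The rational section `v` has a pole of order exactly one at `x`. -/
def HasSimplePole (x : OnePoint k) (v : V) : Prop :=
  localParam x • v ∈ E.stalk x ∧ v ∉ E.stalk x

/-- `e₀` is the canonical section: the rational section of the Hodge filtration with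
`γ e₀ = 1`. -/
def IsCanonicalSection (F : Submodule (RatFunc k) V) (γ : V →ₗ[RatFunc k] RatFunc k)
    (e₀ : V) : Prop := e₀ ∈ F ∧ γ e₀ = 1

/-- The supersingular points are the simple poles of the canonical section. -/
def supersingular (F : Submodule (RatFunc k) V) (γ : V →ₗ[RatFunc k] RatFunc k) :
    Set (OnePoint k) :=
  {x | ∃ e₀, IsCanonicalSection F γ e₀ ∧ E.HasSimplePole x e₀}

/-- `e₁` is an everywhere invertible section over the affine line of the line subbundle with generic
fibre `F`: it generates the stalk at every finite point. -/
def IsAffineGenerator (F : Submodule (RatFunc k) V) (e₁ : V) : Prop :=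
  ∀ a : k, Submodule.span (localRing (a : OnePoint k)) {e₁} =
    E.stalk (a : OnePoint k) ⊓ F.restrictScalars (localRing (a : OnePoint k))

end LogConnection

end Bundle

/-! ### Second order differential operators -/

/-- The operator `u'' + p₁ u' + p₂ u` on `k(t)`. -/
structure DiffOp (k : Type*) [Field k] where
  /-- the coefficient of `u'` -/
  p₁ : RatFunc k
  /-- the coefficient of `u` -/
  p₂ : RatFunc k

namespace DiffOp

variable {k : Type*} [Field k] (L : DiffOp k)

/-- `L(u)`. -/
def eval (u : RatFunc k) : RatFunc k := ddt k (ddt k u) + L.p₁ * ddt k u + L.p₂ * u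

/-- The coefficients `q₁`, `q₂` for which the equation `L(u) = 0` reads
`∂²u + q₁ ∂u + q₂ u = 0`, where `∂ = ∂/∂s` and `s` is the standard local parameter at `x`. At `∞`,
one has `∂/∂t = -s² ∂/∂s` and so `L(u) = s⁴ ∂²u + (2 s³ - s² p₁) ∂u + p₂ u`. -/
def localCoeffs : OnePoint k → RatFunc k × RatFunc k
  | (_ : k) => (L.p₁, L.p₂)
  | ∞ => (2 * RatFunc.X - RatFunc.X ^ 2 * L.p₁, RatFunc.X ^ 4 * L.p₂)

/-- `L` has at most a regular singularity at `x`, with local exponents `ρ₁`, `ρ₂` there: in the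
standard local parameter `s`, the functions `s q₁` and `s² q₂` are regular at `x`, and `ρ₁`, `ρ₂`
are, with multiplicity, the roots of the indicial polynomial `ρ (ρ - 1) + A ρ + B`, where `A` and
`B` are the values of these functions at `x`. -/
def HasLocalExponents (x : OnePoint k) (ρ₁ ρ₂ : k) : Prop :=
  ∃ A B : k, HasValueAt x (localParam x * (L.localCoeffs x).1) A ∧
    HasValueAt x (localParam x ^ 2 * (L.localCoeffs x).2) B ∧
    (X * (X - 1) + C A * X + C B : k[X]) = (X - C ρ₁) * (X - C ρ₂)

end DiffOp

/-- `L` is the differential operator associated to the bundle `E` with Hodge filtration `F`: for an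
everywhere invertible section `e₁` of the Hodge filtration over the affine line and
`e₂ = ∇(D) e₁`, one has `∇(D) e₂ = - p₂ e₁ - p₁ e₂`. -/
def LogConnection.IsAssociated {k : Type*} [Field k] {S : Finset (OnePoint k)} {V : Type*}
    [AddCommGroup V] [Module (RatFunc k) V] [Module k V] [IsScalarTower k (RatFunc k) V]
    (E : LogConnection S V) (F : Submodule (RatFunc k) V) (L : DiffOp k) : Prop :=
  ∃ e₁, E.IsAffineGenerator F e₁ ∧
    E.nabla (ddt k) (E.nabla (ddt k) e₁) = -(L.p₂ • e₁) - L.p₁ • E.nabla (ddt k) e₁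

end P1Indigenous

end

/-! Everything is read off from the function `u = γ e₁`. It is regular on the affine line, hence a
polynomial, and it solves `L(u) = 0` because `γ` is horizontal. The Kodaira–Spencer isomorphism
makes `e₁` and its logarithmic derivative generate every finite stalk. Since `γ` is surjective, `u`
and its derivative have no common zero (`not_both_zero`), so the zeros of `u` are simple. As `e₀ =
u⁻¹ e₁`, they are exactly the finite supersingular points. At a marked point `s ∂/∂s` takes regular
functions to functions vanishing there, so the Hodge filtration alone must map onto the value `1`.
Hence `e₀` is regular there, in particular at `∞` (`exists_canonicalSection`).

Uniqueness comes from activity. Every solution is the value at `e₁` of a horizontal form. Horizontal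
forms kill the `p`-curvature, so two solutions with nonzero Wronskian would force it to vanish
(`wronskian_eq_zero`). Polynomials with simple zeros and zero Wronskian divide each other.

At `∞` put `θ = s ∂/∂s` and `w = ∇(θ) e₀`. Then `e₀, w` generate the stalk and `w` generates that of
`Ker γ`, so `∇(θ) w = h w` and the exponent is `α = h(∞)`. As `θ^p = θ`, the `p`-curvature at `θ`
multiplies the leading coefficient along `w` by `α^p - α`, which nilpotence forces to be zero.
Finally `e₁ = u e₀` and `deg u = d`: the exponents `0, α` of `θ² g = h θ g` are shifted by the order
`-d` of `u` at `∞`. -/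

noncomputable section

namespace P1Indigenous

/-! ### Values of rational functions at a point, and derivations of `k(t)`. -/

section LocalRing

variable {k : Type*} [Field k]

theorem hasValueAt_div (x : OnePoint k) (a b : k[X]) (hb : b.eval 0 ≠ 0) :
    HasValueAt x (aeval (localParam x) a / aeval (localParam x) b) (a.eval 0 / b.eval 0) := by
  have hb0 : b ≠ 0 := by rintro rfl; simp at hb
  have hbK := aeval_localParam_ne_zero x hb0
  obtain ⟨q, hq⟩ : X ∣ a - C (a.eval 0 / b.eval 0) * b := by
    rw [X_dvd_iff, coeff_zero_eq_eval_zero]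
    simp [hb]
  refine ⟨_, ⟨q, b, hb, rfl⟩, ?_⟩
  have h := congrArg (aeval (localParam x)) hq
  simp only [map_sub, map_mul, aeval_C, aeval_X] at h
  field_simp
  linear_combination h

theorem exists_hasValueAt {x : OnePoint k} {f : RatFunc k} (hf : f ∈ localRing x) :
    ∃ c, HasValueAt x f c := by
  obtain ⟨a, b, hb, rfl⟩ := hf
  exact ⟨_, hasValueAt_div x a b hb⟩

namespace HasValueAt

variable {x : OnePoint k} {f g : RatFunc k} {c d : k}

theorem mem (h : HasValueAt x f c) : f ∈ localRing x := by
  obtain ⟨g, hg, rfl⟩ := h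
  exact add_mem (Subalgebra.algebraMap_mem _ c) (mul_mem (localParam_mem x) hg)

theorem add (hf : HasValueAt x f c) (hg : HasValueAt x g d) : HasValueAt x (f + g) (c + d) := by
  obtain ⟨f', hf', rfl⟩ := hf
  obtain ⟨g', hg', rfl⟩ := hg
  exact ⟨f' + g', add_mem hf' hg', by rw [map_add]; ring⟩

theorem mul (hf : HasValueAt x f c) (hg : HasValueAt x g d) : HasValueAt x (f * g) (c * d) := by
  have hgm := hg.mem
  obtain ⟨f', hf', rfl⟩ := hf
  obtain ⟨g', hg', rfl⟩ := hg
  refine ⟨algebraMap k _ c * g' + f' * (algebraMap k (RatFunc k) d + localParam x * g'),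
    add_mem (mul_mem (Subalgebra.algebraMap_mem _ c) hg') (mul_mem hf' hgm), ?_⟩
  rw [map_mul]; ring

theorem const (x : OnePoint k) (c : k) : HasValueAt x (algebraMap k (RatFunc k) c) c :=
  ⟨0, zero_mem _, by simp⟩

theorem one (x : OnePoint k) : HasValueAt x (1 : RatFunc k) 1 := by
  simpa using const x 1

theorem zero (x : OnePoint k) : HasValueAt x (0 : RatFunc k) 0 := by
  simpa using const x 0

theorem neg (hf : HasValueAt x f c) : HasValueAt x (-f) (-c) := by
  simpa using (const x (-1)).mul hf

theorem sub (hf : HasValueAt x f c) (hg : HasValueAt x g d) : HasValueAt x (f - g) (c - d) := by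
  simpa [sub_eq_add_neg] using hf.add hg.neg

theorem localParam_mul (hg : g ∈ localRing x) : HasValueAt x (localParam x * g) 0 :=
  ⟨g, hg, by simp⟩

/-- The local parameter is transcendental over `k`, so an identity between fractions in it becomes a
polynomial identity, which can be evaluated at `0`. -/
theorem unique (hc : HasValueAt x f c) (hd : HasValueAt x f d) : c = d := by
  obtain ⟨g, ⟨a, b, hb, hg⟩, h⟩ := hc.sub hd
  have hb0 : b ≠ 0 := by rintro rfl; simp at hb
  have hbK := aeval_localParam_ne_zero x hb0
  rw [sub_self, hg] at h
  have h1 : C (c - d) * b + X * a = 0 := by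
    by_contra hne
    apply aeval_localParam_ne_zero x hne
    simp only [map_add, map_mul, aeval_C, aeval_X]
    field_simp at h
    linear_combination -h
  have h2 := congrArg (eval 0) h1
  simp only [eval_add, eval_mul, eval_C, eval_X, zero_mul, add_zero, eval_zero, mul_eq_zero, hb,
    or_false] at h2
  exact sub_eq_zero.mp h2

theorem inv (h : HasValueAt x f c) (hc : c ≠ 0) : HasValueAt x f⁻¹ c⁻¹ := by
  obtain ⟨a, b, hb, rfl⟩ := h.mem
  have h1 := h.unique (hasValueAt_div x a b hb)
  have ha : a.eval 0 ≠ 0 := by intro h0; rw [h0, zero_div] at h1; exact hc h1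
  rw [h1, inv_div, inv_div]
  exact hasValueAt_div x b a ha

end HasValueAt

theorem localParam_ne_zero (x : OnePoint k) : localParam x ≠ 0 := by
  simpa using aeval_localParam_ne_zero x X_ne_zero

theorem localDer_mem {x : OnePoint k} {f : RatFunc k} (hf : f ∈ localRing x) :
    localDer x f ∈ localRing x := by
  obtain ⟨a, b, hb, rfl⟩ := hf
  have hb0 : b ≠ 0 := by rintro rfl; simp at hb
  have hbK := aeval_localParam_ne_zero x hb0
  refine ⟨derivative a * b - a * derivative b, b ^ 2, by simpa using hb, ?_⟩
  rw [Derivation.leibniz_div, Derivation.map_aeval, Derivation.map_aeval, localDer_localParam]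
  simp only [smul_eq_mul, map_sub, map_mul, map_pow]
  field_simp

/-- This vanishing lets logarithmic derivatives be ignored whenever leading coefficients at a point
are compared. -/
theorem eulerDer_hasValueAt {x : OnePoint k} {f : RatFunc k} (hf : f ∈ localRing x) :
    HasValueAt x (eulerDer x f) 0 :=
  HasValueAt.localParam_mul (localDer_mem hf)

theorem logDer_mem (S : Finset (OnePoint k)) {x : OnePoint k} {f : RatFunc k}
    (hf : f ∈ localRing x) : logDer S x f ∈ localRing x := by
  unfold logDer
  split_ifs
  · exact (eulerDer_hasValueAt hf).mem
  · exact localDer_mem hf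

theorem algebraMap_eq_aeval_localParam (a : k) (q : k[X]) :
    algebraMap k[X] (RatFunc k) q =
      aeval (localParam (a : OnePoint k)) (q.comp (X + C a)) := by
  have h : aeval (localParam (a : OnePoint k)) (X + C a) = (RatFunc.X : RatFunc k) := by
    change aeval (RatFunc.X - RatFunc.C a : RatFunc k) (X + C a) = (RatFunc.X : RatFunc k)
    simp [RatFunc.algebraMap_eq_C]
  rw [aeval_comp, h, ← RatFunc.algebraMap_X, aeval_algebraMap_apply]
  simp

theorem hasValueAt_algebraMap (a : k) (q : k[X]) :
    HasValueAt (a : OnePoint k) (algebraMap k[X] (RatFunc k) q) (q.eval a) := by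
  have h := hasValueAt_div (a : OnePoint k) (q.comp (X + C a)) 1 (by simp)
  rw [algebraMap_eq_aeval_localParam a q]
  simpa using h

/-- A rational function which is regular on the affine line is a polynomial. -/
theorem exists_algebraMap_eq [IsAlgClosed k] {f : RatFunc k}
    (hf : ∀ a : k, f ∈ localRing (a : OnePoint k)) :
    ∃ q : k[X], algebraMap k[X] (RatFunc k) q = f := by
  have hd : f.denom = 1 := by
    by_contra hne
    have hdeg : f.denom.degree ≠ 0 := fun h =>
      hne ((RatFunc.monic_denom f).degree_le_zero_iff_eq_one.mp h.le)
    obtain ⟨a, ha⟩ := IsAlgClosed.exists_root _ hdeg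
    obtain ⟨c, hc⟩ := exists_hasValueAt (hf a)
    have h1 := hc.mul (hasValueAt_algebraMap a f.denom)
    have h2 : f * algebraMap k[X] (RatFunc k) f.denom = algebraMap k[X] (RatFunc k) f.num := by
      have h3 := RatFunc.num_div_denom f
      rwa [div_eq_iff (ratFunc_algebraMap_ne (RatFunc.denom_ne_zero f)), eq_comm] at h3
    -- A root of the denominator would be a root of the numerator too, against coprimality.
    rw [h2, ha, mul_zero] at h1
    have h3 := h1.unique (hasValueAt_algebraMap a f.num)
    obtain ⟨r, s, hrs⟩ := RatFunc.isCoprime_num_denom f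
    have := congrArg (eval a) hrs
    simp [← h3, ha.eq_zero] at this
  refine ⟨f.num, ?_⟩
  conv_rhs => rw [← RatFunc.num_div_denom f, hd]
  simp

/-- A derivation of `k(t)` is determined by its value at `t`, so identities of derivations and
horizontality need testing only on `t` and `∂/∂t`. -/
theorem derivation_eq_smul_ddt (δ : Derivation k (RatFunc k) (RatFunc k)) :
    δ = δ RatFunc.X • ddt k := by
  have h : ∀ q : k[X], δ (algebraMap k[X] (RatFunc k) q) =
      δ RatFunc.X * ddt k (algebraMap k[X] (RatFunc k) q) := by
    intro q
    have hq : algebraMap k[X] (RatFunc k) q = aeval (RatFunc.X : RatFunc k) q := by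
      rw [← RatFunc.algebraMap_X, aeval_algebraMap_apply]; simp
    rw [hq, Derivation.map_aeval, Derivation.map_aeval, ddt_X]
    simp [mul_comm]
  ext f
  rw [← RatFunc.num_div_denom f, Derivation.leibniz_div, Derivation.smul_apply,
    Derivation.leibniz_div, h, h]
  simp only [smul_eq_mul]
  ring

theorem eulerDer_infty : eulerDer (∞ : OnePoint k) = -((RatFunc.X : RatFunc k) • ddt k) := by
  rw [derivation_eq_smul_ddt (eulerDer (∞ : OnePoint k)), ← neg_smul]
  congr 1
  change RatFunc.X⁻¹ * (-((RatFunc.X ^ 2 : RatFunc k) * ddt k RatFunc.X)) = _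
  rw [ddt_X]
  have := RatFunc.X_ne_zero (K := k)
  field_simp

/-- Both sides are derivations, so it suffices to compare them at `t`, where `s ∂/∂s` has eigenvalue
`-1` and `(-1)^p = -1` for odd `p`. -/
theorem derivPow_eulerDer_infty (p : ℕ) [Fact p.Prime] [CharP k p] (hp : p ≠ 2) :
    derivPow p (eulerDer (∞ : OnePoint k)) = eulerDer ∞ := by
  have hX : eulerDer (∞ : OnePoint k) RatFunc.X = -RatFunc.X := by
    rw [eulerDer_infty]; simp [ddt_X]
  rw [derivation_eq_smul_ddt (derivPow p _)]
  conv_rhs => rw [derivation_eq_smul_ddt (eulerDer _)]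
  congr 1
  have h : ∀ n : ℕ, ((eulerDer (∞ : OnePoint k) : RatFunc k →ₗ[k] RatFunc k) ^ n) RatFunc.X =
      (-1) ^ n * RatFunc.X := by
    intro n
    induction n with
    | zero => simp
    | succ n ih =>
      rw [pow_succ, Module.End.mul_apply, Derivation.coeFn_coe, hX, map_neg, ih]
      ring
  change ((eulerDer (∞ : OnePoint k) : RatFunc k →ₗ[k] RatFunc k) ^ p) RatFunc.X = _
  rw [h, hX, (Nat.Prime.odd_of_ne_two Fact.out hp).neg_one_pow, neg_one_mul]

/-- The logarithmic derivative of a polynomial at infinity. -/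
theorem hasValueAt_infty_logDeriv {q : k[X]} (hq : q ≠ 0) :
    HasValueAt ∞ (-(RatFunc.X * algebraMap k[X] (RatFunc k) (derivative q) /
      algebraMap k[X] (RatFunc k) q)) (-(q.natDegree : k)) := by
  set U : RatFunc k := aeval (localParam (∞ : OnePoint k)) q.reverse with hU
  have hX := RatFunc.X_ne_zero (K := k)
  have hrev : q.reverse ≠ 0 := by simpa using hq
  have hU0 : U ≠ 0 := aeval_localParam_ne_zero _ hrev
  have hqK := ratFunc_algebraMap_ne hq
  have hfU : algebraMap k[X] (RatFunc k) q = RatFunc.X ^ q.natDegree * U := by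
    let _ := invertibleOfNonzero hX
    have h := eval₂_reverse_mul_pow (algebraMap k (RatFunc k)) (RatFunc.X : RatFunc k) q
    rw [invOf_eq_inv] at h
    rw [mul_comm]
    refine Eq.trans ?_ h.symm
    rw [← aeval_def, ← RatFunc.algebraMap_X, aeval_algebraMap_apply]
    simp
  have hUv : HasValueAt ∞ U q.leadingCoeff := by
    have := hasValueAt_div ∞ q.reverse 1 (by simp)
    simpa [← coeff_zero_eq_eval_zero] using this
  have hv := (eulerDer_hasValueAt hUv.mem).mul (hUv.inv (by simpa using hq))
  -- The left side is `θ q / q` for `θ = s ∂/∂s = -t ∂/∂t`. In `q = t^n U` the factor `t^n`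
  -- contributes `-n`, and `U` is a unit at `∞`, so `θ U / U` vanishes there.
  have key : -(RatFunc.X * algebraMap k[X] (RatFunc k) (derivative q) /
      algebraMap k[X] (RatFunc k) q) =
      algebraMap k (RatFunc k) (-(q.natDegree : k)) + eulerDer ∞ U * U⁻¹ := by
    have hpow : ∀ n : ℕ, eulerDer (∞ : OnePoint k) (RatFunc.X ^ n) =
        -(algebraMap k (RatFunc k) n * RatFunc.X ^ n) := by
      intro n
      induction n with
      | zero => simp
      | succ n ih =>
        rw [pow_succ, Derivation.leibniz, ih, eulerDer_infty]
        simp only [Derivation.neg_apply, Derivation.smul_apply, ddt_X, smul_eq_mul, map_add, map_one,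
          Nat.cast_succ]
        ring
    have h1 := congrArg (eulerDer (∞ : OnePoint k)) hfU
    rw [Derivation.leibniz, hpow] at h1
    have h2 : eulerDer (∞ : OnePoint k) (algebraMap k[X] (RatFunc k) q) =
        -(RatFunc.X * algebraMap k[X] (RatFunc k) (derivative q)) := by
      rw [eulerDer_infty, ← ddt_algebraMap]; simp
    rw [h2] at h1
    rw [← neg_div, h1, hfU, map_neg]
    simp only [smul_eq_mul]
    field_simp
    ring
  rw [key]
  have h := (HasValueAt.const ∞ (-(q.natDegree : k))).add hv
  rwa [zero_mul, add_zero] at h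

end LocalRing

/-! ### The Hodge filtration, the `p`-curvature and solutions of `L`. -/

namespace LogConnection

variable {k : Type*} [Field k] {S : Finset (OnePoint k)} {V : Type*} [AddCommGroup V]
  [Module (RatFunc k) V] [Module k V] [IsScalarTower k (RatFunc k) V] {E : LogConnection S V}
  {F : Submodule (RatFunc k) V} {γ : V →ₗ[RatFunc k] RatFunc k}

theorem smul_mem_stalk {x : OnePoint k} {g : RatFunc k} (hg : g ∈ localRing x) {v : V}
    (hv : v ∈ E.stalk x) : g • v ∈ E.stalk x :=
  (E.stalk x).smul_mem (⟨g, hg⟩ : localRing x) hv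

/-- This is surjectivity of the Kodaira–Spencer map, lifted from the quotient. -/
theorem IsHodgeFiltration.exists_decomp (hF : E.IsHodgeFiltration F) {x : OnePoint k} {v : V}
    (hv : v ∈ E.stalk x) : ∃ e ∈ E.stalk x, e ∈ F ∧ ∃ e' ∈ E.stalk x, e' ∈ F ∧
      v = E.nabla (logDer S x) e + e' := by
  obtain ⟨⟨⟨e, he⟩, heF⟩, h⟩ := (hF.bijective x).2 (Submodule.Quotient.mk ⟨v, hv⟩)
  have h1 := (Submodule.Quotient.eq _).mp h
  have h2 : E.nabla (logDer S x) e - v ∈ F := h1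
  refine ⟨e, he, heF, v - E.nabla (logDer S x) e, sub_mem hv (E.log x e he), ?_, by abel⟩
  rw [← neg_sub]
  exact neg_mem h2

/-- If `e` generates the Hodge filtration at `x`, then `e` and `∇(D) e` generate the bundle. -/
theorem IsHodgeFiltration.exists_coeffs (hF : E.IsHodgeFiltration F) {x : OnePoint k} {e : V}
    (hgen : ∀ y ∈ E.stalk x, y ∈ F → ∃ g ∈ localRing x, y = g • e) {v : V}
    (hv : v ∈ E.stalk x) : ∃ g ∈ localRing x, ∃ g' ∈ localRing x,
      v = g • e + g' • E.nabla (logDer S x) e := by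
  obtain ⟨y, hy, hyF, y', hy', hyF', rfl⟩ := hF.exists_decomp hv
  obtain ⟨g, hg, rfl⟩ := hgen y hy hyF
  obtain ⟨g', hg', rfl⟩ := hgen y' hy' hyF'
  refine ⟨logDer S x g + g', add_mem (logDer_mem S hg) hg', g, hg, ?_⟩
  rw [E.leibniz, add_smul]
  abel

theorem IsHodgeFiltration.span_eq_top (hF : E.IsHodgeFiltration F) (hE : E.IsVectorBundle)
    {x : OnePoint k} {e : V}
    (hgen : ∀ y ∈ E.stalk x, y ∈ F → ∃ g ∈ localRing x, y = g • e) :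
    Submodule.span (RatFunc k) {e, E.nabla (logDer S x) e} = ⊤ := by
  rw [eq_top_iff, ← hE.spans x, Submodule.span_le]
  intro v hv
  obtain ⟨g, -, g', -, rfl⟩ := hF.exists_coeffs hgen hv
  exact Submodule.mem_span_pair.mpr ⟨g, g', rfl⟩

theorem linearIndependent_of_span_pair {K : Type*} [Field K] {W : Type*} [AddCommGroup W]
    [Module K W] (h2 : Module.finrank K W = 2) {a b : W} (h : Submodule.span K {a, b} = ⊤) :
    LinearIndependent K ![a, b] := by
  apply linearIndependent_of_top_le_span_of_card_eq_finrank
  · rw [Matrix.range_cons, Matrix.range_cons, Matrix.range_empty, Set.union_empty,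
      Set.singleton_union, h]
  · simp [h2]

/-- The value of `γ` on a generator `e` of the Hodge filtration at `x` and on `∇(D) e` cannot both
vanish at `x`. -/
theorem IsHodgeFiltration.not_both_zero (hF : E.IsHodgeFiltration F)
    (hγ : E.IsNormalization γ) {x : OnePoint k} {e : V}
    (hgen : ∀ y ∈ E.stalk x, y ∈ F → ∃ g ∈ localRing x, y = g • e)
    (h0 : HasValueAt x (γ e) 0) (h1 : HasValueAt x (logDer S x (γ e)) 0) : False := by
  have hone : (1 : RatFunc k) ∈ γ '' (E.stalk x : Set V) := by
    rw [hγ.surjective]; exact one_mem (localRing x)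
  obtain ⟨v, hv, hv1⟩ := hone
  obtain ⟨g, hg, g', hg', rfl⟩ := hF.exists_coeffs hgen hv
  obtain ⟨c, hc⟩ := exists_hasValueAt hg
  obtain ⟨c', hc'⟩ := exists_hasValueAt hg'
  rw [map_add, map_smul, map_smul, hγ.horizontal, smul_eq_mul, smul_eq_mul] at hv1
  have h := (hc.mul h0).add (hc'.mul h1)
  rw [hv1] at h
  simpa using h.unique (HasValueAt.one x)

theorem IsNormalization.map_mem (hγ : E.IsNormalization γ) {x : OnePoint k} {v : V}
    (hv : v ∈ E.stalk x) : γ v ∈ localRing x := by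
  have : γ v ∈ γ '' (E.stalk x : Set V) := ⟨v, hv, rfl⟩
  rwa [hγ.surjective] at this

/-- At a marked point the Hodge filtration has a section with `γ e = 1`. -/
theorem IsHodgeFiltration.exists_canonicalSection (hF : E.IsHodgeFiltration F)
    (hγ : E.IsNormalization γ) {x : OnePoint k} (hx : x ∈ S) :
    ∃ e ∈ E.stalk x, IsCanonicalSection F γ e := by
  have hone : (1 : RatFunc k) ∈ γ '' (E.stalk x : Set V) := by
    rw [hγ.surjective]; exact one_mem (localRing x)
  obtain ⟨v, hv, hv1⟩ := hone
  obtain ⟨y, hy, hyF, y', hy', hyF', rfl⟩ := hF.exists_decomp hv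
  obtain ⟨c, hc⟩ := exists_hasValueAt (hγ.map_mem hy')
  rw [map_add, hγ.horizontal, logDer, if_pos hx] at hv1
  -- The derivative term vanishes at `x`, so `γ y'` has value `1` there and can be inverted.
  have h := (eulerDer_hasValueAt (hγ.map_mem hy)).add hc
  rw [hv1] at h
  have hc1 := h.unique (HasValueAt.one x)
  rw [zero_add] at hc1
  have hc0 : c ≠ 0 := by rw [hc1]; exact one_ne_zero
  have hne : γ y' ≠ 0 := by
    intro h0; rw [h0] at hc; exact hc0 (hc.unique (HasValueAt.zero x))
  refine ⟨(γ y')⁻¹ • y', smul_mem_stalk (hc.inv hc0).mem hy', F.smul_mem _ hyF', ?_⟩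
  rw [map_smul, smul_eq_mul, inv_mul_cancel₀ hne]

theorem IsHodgeFiltration.exists_smul_eq (hF : E.IsHodgeFiltration F) {e : V} (he : e ∈ F)
    (he0 : e ≠ 0) {v : V} (hv : v ∈ F) : ∃ c : RatFunc k, v = c • e := by
  obtain ⟨c, hc⟩ := exists_smul_eq_of_finrank_eq_one hF.rank_one
    (x := (⟨e, he⟩ : F)) (by simpa [Subtype.ext_iff] using he0) ⟨v, hv⟩
  exact ⟨c, (congrArg Subtype.val hc).symm⟩

theorem nabla_iterate (δ : Derivation k (RatFunc k) (RatFunc k)) {φ : V →ₗ[RatFunc k] RatFunc k}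
    (hφ : ∀ v, φ (E.nabla δ v) = δ (φ v)) (n : ℕ) (v : V) :
    φ (((E.nabla δ : Module.End k V) ^ n) v) =
      ((δ : RatFunc k →ₗ[k] RatFunc k) ^ n) (φ v) := by
  induction n generalizing v with
  | zero => rfl
  | succ n ih => rw [pow_succ, pow_succ, Module.End.mul_apply, Module.End.mul_apply, ih, hφ]; rfl

/-- A horizontal form intertwines the `p`-curvature with that of the trivial connection, which is
zero. -/
theorem horizontal_pCurvature (p : ℕ) [Fact p.Prime] [CharP k p]
    {φ : V →ₗ[RatFunc k] RatFunc k} (hφ : ∀ δ v, φ (E.nabla δ v) = δ (φ v))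
    (δ : Derivation k (RatFunc k) (RatFunc k)) (v : V) : φ (E.pCurvature p δ v) = 0 := by
  rw [pCurvature, LinearMap.sub_apply, map_sub, nabla_iterate δ (hφ δ), hφ]
  exact sub_self _

/-- If two horizontal forms on a bundle are jointly injective, then the `p`-curvature vanishes. -/
theorem not_isActive (p : ℕ) [Fact p.Prime] [CharP k p]
    {φ ψ : V →ₗ[RatFunc k] RatFunc k} (hφ : ∀ δ v, φ (E.nabla δ v) = δ (φ v))
    (hψ : ∀ δ v, ψ (E.nabla δ v) = δ (ψ v)) (hinj : ∀ v, φ v = 0 → ψ v = 0 → v = 0) :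
    ¬ E.IsActive p := by
  rintro ⟨δ, h⟩
  apply h
  ext v
  exact hinj _ (horizontal_pCurvature p hφ δ v) (horizontal_pCurvature p hψ δ v)

theorem horizontal_of_ddt {φ : V →ₗ[RatFunc k] RatFunc k}
    (hφ : ∀ v, φ (E.nabla (ddt k) v) = ddt k (φ v))
    (δ : Derivation k (RatFunc k) (RatFunc k)) (v : V) : φ (E.nabla δ v) = δ (φ v) := by
  rw [derivation_eq_smul_ddt δ, map_smul, LinearMap.smul_apply, map_smul, hφ]
  rfl

/-- The solutions of the associated equation are the values at `e₁` of the horizontal forms. -/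
theorem exists_horizontal {L : DiffOp k} {e₁ : V}
    (hind : LinearIndependent (RatFunc k) ![e₁, E.nabla (ddt k) e₁])
    (hspan : Submodule.span (RatFunc k) {e₁, E.nabla (ddt k) e₁} = ⊤)
    (hL : E.nabla (ddt k) (E.nabla (ddt k) e₁) = -(L.p₂ • e₁) - L.p₁ • E.nabla (ddt k) e₁)
    {v : RatFunc k} (hv : L.eval v = 0) :
    ∃ φ : V →ₗ[RatFunc k] RatFunc k, (∀ δ v, φ (E.nabla δ v) = δ (φ v)) ∧ φ e₁ = v := by
  let b := Module.Basis.mk hind (by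
    rw [Matrix.range_cons, Matrix.range_cons, Matrix.range_empty, Set.union_empty,
      Set.singleton_union, hspan])
  -- Horizontality at `e₁` dictates these values; at `∇(D) e₁` it is then precisely `L(v) = 0`.
  let φ : V →ₗ[RatFunc k] RatFunc k := b.constr (RatFunc k) ![v, ddt k v]
  have h1 : φ e₁ = v := by
    have h := b.constr_basis (RatFunc k) ![v, ddt k v] 0
    rwa [Module.Basis.mk_apply] at h
  have h2 : φ (E.nabla (ddt k) e₁) = ddt k v := by
    have h := b.constr_basis (RatFunc k) ![v, ddt k v] 1
    rwa [Module.Basis.mk_apply] at h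
  refine ⟨φ, horizontal_of_ddt fun y => ?_, h1⟩
  have hy : y ∈ Submodule.span (RatFunc k) {e₁, E.nabla (ddt k) e₁} := by rw [hspan]; trivial
  obtain ⟨c, c', rfl⟩ := Submodule.mem_span_pair.mp hy
  unfold DiffOp.eval at hv
  rw [map_add, E.leibniz, E.leibniz, hL]
  simp only [map_add, map_sub, map_neg, map_smul, h1, h2, Derivation.leibniz, smul_eq_mul]
  linear_combination -c' * hv

/-- Two solutions of the equation associated to an active bundle have vanishing Wronskian. -/
theorem wronskian_eq_zero (p : ℕ) [Fact p.Prime] [CharP k p] (hactive : E.IsActive p)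
    {L : DiffOp k} {e₁ : V}
    (hind : LinearIndependent (RatFunc k) ![e₁, E.nabla (ddt k) e₁])
    (hspan : Submodule.span (RatFunc k) {e₁, E.nabla (ddt k) e₁} = ⊤)
    (hL : E.nabla (ddt k) (E.nabla (ddt k) e₁) = -(L.p₂ • e₁) - L.p₁ • E.nabla (ddt k) e₁)
    {u v : RatFunc k} (hu : L.eval u = 0) (hv : L.eval v = 0) :
    u * ddt k v - ddt k u * v = 0 := by
  by_contra hW
  obtain ⟨φ, hφ, hφ1⟩ := exists_horizontal hind hspan hL hu
  obtain ⟨ψ, hψ, hψ1⟩ := exists_horizontal hind hspan hL hv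
  refine not_isActive p hφ hψ (fun y h1 h2 => ?_) hactive
  have hy : y ∈ Submodule.span (RatFunc k) {e₁, E.nabla (ddt k) e₁} := by rw [hspan]; trivial
  obtain ⟨c, c', rfl⟩ := Submodule.mem_span_pair.mp hy
  rw [map_add, map_smul, map_smul, hφ, hφ1, smul_eq_mul, smul_eq_mul] at h1
  rw [map_add, map_smul, map_smul, hψ, hψ1, smul_eq_mul, smul_eq_mul] at h2
  -- The Wronskian is the determinant of the system `h1`, `h2` in `c`, `c'`; Cramer's rule.
  have hc : c = 0 := by
    apply (mul_eq_zero.mp _).resolve_right hW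
    linear_combination ddt k v * h1 - ddt k u * h2
  have hc' : c' = 0 := by
    apply (mul_eq_zero.mp _).resolve_right hW
    linear_combination u * h2 - v * h1
  rw [hc, hc']; simp

end LogConnection

/-- Two polynomials over an algebraically closed field with only simple zeros and vanishing
Wronskian are proportional. -/
theorem exists_eq_C_mul {k : Type*} [Field k] [IsAlgClosed k] {u v : k[X]} (hu : u ≠ 0)
    (hv : v ≠ 0) (hu1 : ∀ a, u.IsRoot a → u.rootMultiplicity a = 1)
    (hv1 : ∀ a, v.IsRoot a → v.rootMultiplicity a = 1)
    (h : u * derivative v - derivative u * v = 0) : ∃ c : k, c ≠ 0 ∧ v = C c * u := by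
  have cop : ∀ w : k[X], w ≠ 0 → (∀ a, w.IsRoot a → w.rootMultiplicity a = 1) →
      IsCoprime w (derivative w) := by
    intro w hw hw1
    classical
    rw [← separable_def, ← nodup_roots_iff_of_splits hw (IsAlgClosed.splits w)]
    rw [Multiset.nodup_iff_count_le_one]
    intro a
    rw [count_roots]
    by_cases ha : w.IsRoot a
    · exact (hw1 a ha).le
    · rw [rootMultiplicity_eq_zero ha]; exact zero_le_one
  -- Vanishing of the Wronskian shows that `u` divides `u' v`.
  have huv : u ∣ v := (cop u hu hu1).dvd_of_dvd_mul_left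
    ⟨derivative v, by linear_combination -h⟩
  have hvu : v ∣ u := (cop v hv hv1).dvd_of_dvd_mul_left
    ⟨derivative u, by linear_combination h⟩
  obtain ⟨w, hw⟩ := associated_of_dvd_dvd huv hvu
  obtain ⟨c, hc, hcw⟩ := Polynomial.isUnit_iff.mp w.isUnit
  exact ⟨c, hc.ne_zero, by rw [← hw, ← hcw, mul_comm]⟩

/-! ### Local exponents at a point and at infinity. -/

namespace LogConnection

variable {k : Type*} [Field k] {S : Finset (OnePoint k)} {V : Type*} [AddCommGroup V]
  [Module (RatFunc k) V] [Module k V] [IsScalarTower k (RatFunc k) V] {E : LogConnection S V}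
  {F : Submodule (RatFunc k) V} {γ : V →ₗ[RatFunc k] RatFunc k}

theorem mem_maxStalk_iff {x : OnePoint k} {v : E.stalk x} :
    v ∈ E.maxStalk x ↔ ∃ v', v = localParamO x • v' := by
  unfold maxStalk maxIdeal
  rw [Submodule.restrictScalars_mem, Submodule.ideal_span_singleton_smul,
    Submodule.mem_smul_pointwise_iff_exists]
  constructor
  · rintro ⟨w', -, h⟩; exact ⟨w', h.symm⟩
  · rintro ⟨w', h⟩; exact ⟨w', trivial, h.symm⟩

/-- The local exponent of a line bundle whose stalk at `x` is generated by `w`. -/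
theorem IsNormalization.kernel_isLocalExponent_iff (hγ : E.IsNormalization γ) {x : OnePoint k}
    {w : V} (hw0 : w ≠ 0) (hw : w ∈ E.stalk x) (hγw : γ w = 0)
    (hgen : ∀ y ∈ E.stalk x, γ y = 0 → ∃ g ∈ localRing x, y = g • w)
    {h : RatFunc k} (hh : E.nabla (eulerDer x) w = h • w) {α : k} (hα : HasValueAt x h α)
    (β : k) : hγ.kernel.IsLocalExponent x β ↔ β = α := by
  let w' : hγ.kernel.stalk x := ⟨⟨w, hγw⟩, hw⟩
  have hscal : ∀ q : hγ.kernel.Fiber x, hγ.kernel.monodromy x q = α • q := by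
    intro q
    obtain ⟨y, rfl⟩ := Submodule.mkQ_surjective _ q
    change Submodule.mkQ _ (hγ.kernel.eulerStalk x y) = α • Submodule.mkQ _ y
    rw [← map_smul, ← sub_eq_zero, ← map_sub, Submodule.mkQ_apply, Submodule.Quotient.mk_eq_zero,
      mem_maxStalk_iff]
    obtain ⟨g, hg, hyg⟩ := hgen ((y : LinearMap.ker γ) : V) y.2 (y : LinearMap.ker γ).2
    obtain ⟨h', hh', rfl⟩ := hα
    -- With `h = α + s h'`, Leibniz gives `∇(θ)(g w) - α g w = s (∂g + g h') w`.
    refine ⟨(⟨localDer x g + g * h', add_mem (localDer_mem hg) (mul_mem hg hh')⟩ :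
      localRing x) • w', ?_⟩
    ext
    change E.nabla (eulerDer x) ((y : LinearMap.ker γ) : V) - α • ((y : LinearMap.ker γ) : V) =
      localParam x • ((localDer x g + g * h') • w)
    have hE : eulerDer x g = localParam x * localDer x g := rfl
    rw [hyg, E.leibniz, hh, ← algebraMap_smul (RatFunc k) α (g • w), hE]
    simp only [smul_smul, ← add_smul, ← sub_smul]
    congr 1
    ring
  -- The fibre is nonzero, so `α` really occurs: otherwise `s` would be a unit of the local ring.
  have hne : Submodule.mkQ (hγ.kernel.maxStalk x) w' ≠ 0 := by
    intro h0
    rw [Submodule.mkQ_apply, Submodule.Quotient.mk_eq_zero, mem_maxStalk_iff] at h0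
    obtain ⟨v, hv⟩ := h0
    obtain ⟨g, hg, hvg⟩ := hgen ((v : LinearMap.ker γ) : V) v.2 (v : LinearMap.ker γ).2
    have h1 : w = localParam x • ((v : LinearMap.ker γ) : V) :=
      congrArg (fun z : hγ.kernel.stalk x => ((z : LinearMap.ker γ) : V)) hv
    rw [hvg, smul_smul] at h1
    have h2 : localParam x * g = 1 := by
      apply smul_left_injective (RatFunc k) hw0
      simpa using h1.symm
    have h3 := HasValueAt.localParam_mul hg
    rw [h2] at h3
    exact one_ne_zero ((HasValueAt.one x).unique h3)
  unfold IsLocalExponent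
  constructor
  · intro hβ
    obtain ⟨q, hq⟩ := hβ.exists_hasEigenvector
    have h1 := hq.apply_eq_smul
    rw [hscal] at h1
    exact (smul_left_injective k hq.2 h1).symm
  · rintro rfl
    exact Module.End.hasEigenvalue_of_hasEigenvector
      ⟨Module.End.mem_eigenspace_iff.mpr (hscal _), hne⟩

/-- The local exponents at infinity of a bundle with nilpotent `p`-curvature lie in the prime
field. -/
theorem IsNilpotentCurv.pow_eq_self (p : ℕ) [Fact p.Prime] [CharP k p] (hp : p ≠ 2)
    (hnilp : E.IsNilpotentCurv p) {w : V} (hw0 : w ≠ 0) {h : RatFunc k}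
    (hh : E.nabla (eulerDer ∞) w = h • w) {α : k} (hα : HasValueAt ∞ h α) : α ^ p = α := by
  -- `P y c` tracks the leading coefficient `c` of `y` along `w`; `∇(θ)` multiplies it by `α`.
  let P : V → k → Prop := fun y c => ∃ g : RatFunc k, HasValueAt ∞ g c ∧ y = g • w
  have hθ : ∀ y c, P y c → P (E.nabla (eulerDer ∞) y) (α * c) := by
    rintro y c ⟨g, hg, rfl⟩
    refine ⟨eulerDer ∞ g + h * g, ?_, ?_⟩
    · have := (eulerDer_hasValueAt hg.mem).add (hα.mul hg)
      rwa [zero_add] at this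
    · rw [E.leibniz, hh, add_smul, smul_smul, mul_comm g h]
  have hθn : ∀ (n : ℕ) y c, P y c →
      P (((E.nabla (eulerDer ∞) : Module.End k V) ^ n) y) (α ^ n * c) := by
    intro n
    induction n with
    | zero => intro y c hy; simpa using hy
    | succ n ih =>
      intro y c hy
      have := hθ _ _ (ih y c hy)
      rw [pow_succ', pow_succ', Module.End.mul_apply, mul_assoc]
      exact this
  have hT : ∀ y c, P y c → P (E.pCurvature p (eulerDer ∞) y) ((α ^ p - α) * c) := by
    intro y c hy
    obtain ⟨g, hg, hgy⟩ := hθn p y c hy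
    obtain ⟨g', hg', hgy'⟩ := hθ y c hy
    refine ⟨g - g', ?_, ?_⟩
    · rw [sub_mul]; exact hg.sub hg'
    · rw [pCurvature, derivPow_eulerDer_infty p hp, LinearMap.sub_apply, hgy, hgy', sub_smul]
  obtain ⟨n, hn⟩ := hnilp (eulerDer ∞)
  have hTn : ∀ m : ℕ, P ((E.pCurvature p (eulerDer ∞) ^ m) w) ((α ^ p - α) ^ m) := by
    intro m
    induction m with
    | zero => exact ⟨1, by simpa using HasValueAt.one ∞, by simp⟩
    | succ m ih =>
      rw [pow_succ', pow_succ', Module.End.mul_apply]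
      exact hT _ _ ih
  obtain ⟨g, hg, hgw⟩ := hTn n
  rw [hn, LinearMap.zero_apply, eq_comm, smul_eq_zero, or_iff_left hw0] at hgw
  rw [hgw] at hg
  exact sub_eq_zero.mp (eq_zero_of_pow_eq_zero (hg.unique (HasValueAt.zero ∞)))

/-- The local exponents at infinity of the operator with solutions `f g`, where `g` runs through the
solutions of `θ² g = h θ g`, with `θ = s ∂/∂s`. -/
theorem hasLocalExponents_infty {L : DiffOp k} {f : k[X]} (hf : f ≠ 0) {h : RatFunc k} {α : k}
    (hα : HasValueAt ∞ h α) {e₀ w : V} (hind : LinearIndependent (RatFunc k) ![e₀, w])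
    (he₀ : E.nabla (eulerDer ∞) e₀ = w) (hw : E.nabla (eulerDer ∞) w = h • w)
    (hL : E.nabla (ddt k) (E.nabla (ddt k) (algebraMap k[X] (RatFunc k) f • e₀)) =
      -(L.p₂ • algebraMap k[X] (RatFunc k) f • e₀) -
        L.p₁ • E.nabla (ddt k) (algebraMap k[X] (RatFunc k) f • e₀)) :
    L.HasLocalExponents ∞ (-(f.natDegree : k) + α) (-(f.natDegree : k)) := by
  have hX := RatFunc.X_ne_zero (K := k)
  have hfK := ratFunc_algebraMap_ne hf
  have hD : ddt k = (-(RatFunc.X : RatFunc k)⁻¹) • eulerDer (∞ : OnePoint k) := by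
    rw [eulerDer_infty, smul_neg, neg_smul, neg_neg, smul_smul, inv_mul_cancel₀ hX, one_smul]
  have hDe : E.nabla (ddt k) e₀ = (-(RatFunc.X : RatFunc k)⁻¹) • w := by
    rw [hD, map_smul, LinearMap.smul_apply, he₀]
  have hDw : E.nabla (ddt k) w = (-(RatFunc.X : RatFunc k)⁻¹ * h) • w := by
    rw [hD, map_smul, LinearMap.smul_apply, hw, smul_smul]
  set a := algebraMap k[X] (RatFunc k) f with ha
  set a' := algebraMap k[X] (RatFunc k) (derivative f) with ha'
  set a'' := algebraMap k[X] (RatFunc k) (derivative (derivative f)) with ha''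
  have hda : ddt k a = a' := ddt_algebraMap f
  have hda' : ddt k a' = a'' := ddt_algebraMap _
  have hdX : ddt k (-(RatFunc.X : RatFunc k)⁻¹) = (RatFunc.X ^ 2)⁻¹ := by
    rw [map_neg, Derivation.leibniz_inv, ddt_X]
    simp
  have h1 : E.nabla (ddt k) (a • e₀) = a' • e₀ + (a * -(RatFunc.X : RatFunc k)⁻¹) • w := by
    rw [E.leibniz, hDe, hda, smul_smul]
  have h2 : E.nabla (ddt k) (E.nabla (ddt k) (a • e₀)) = a'' • e₀ +
      (a' * -(RatFunc.X : RatFunc k)⁻¹ + (a * (RatFunc.X ^ 2)⁻¹ + -(RatFunc.X : RatFunc k)⁻¹ * a') +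
        a * -(RatFunc.X : RatFunc k)⁻¹ * (-(RatFunc.X : RatFunc k)⁻¹ * h)) • w := by
    rw [h1, map_add, E.leibniz, E.leibniz, hDe, hDw, hda', Derivation.leibniz, hda, hdX]
    simp only [smul_smul, add_smul, smul_eq_mul]
    abel
  rw [h2, h1] at hL
  -- The coefficients of `e₀` and `w` in `L` applied to `f e₀`; their vanishing determines `p₂` and
  -- `p₁`.
  have h3 := LinearIndependent.pair_iff.mp hind (a'' + L.p₂ * a + L.p₁ * a')
    ((a' * -(RatFunc.X : RatFunc k)⁻¹ + (a * (RatFunc.X ^ 2)⁻¹ + -(RatFunc.X : RatFunc k)⁻¹ * a') +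
        a * -(RatFunc.X : RatFunc k)⁻¹ * (-(RatFunc.X : RatFunc k)⁻¹ * h)) +
        L.p₁ * (a * -(RatFunc.X : RatFunc k)⁻¹)) (by
      rw [← sub_eq_zero] at hL
      rw [← hL]
      simp only [smul_smul, add_smul, smul_add]
      abel)
  obtain ⟨h3, h4⟩ := h3
  -- `φ = θ f / f` has value `-deg f` at `∞`, and `p₁`, `p₂` are expressed through `φ`, `h` and `θ
  -- φ`.
  set φ : RatFunc k := -(RatFunc.X * a' / a) with hφ
  have hφv : HasValueAt ∞ φ (-(f.natDegree : k)) := hasValueAt_infty_logDeriv hf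
  have hp1 : RatFunc.X * L.p₁ = 2 * φ + 1 + h := by
    rw [hφ]
    field_simp at h4 ⊢
    linear_combination -h4
  have hθφ : eulerDer ∞ φ = -φ + RatFunc.X ^ 2 * a'' / a - φ ^ 2 := by
    rw [eulerDer_infty, Derivation.neg_apply, Derivation.smul_apply, hφ, map_neg,
      Derivation.leibniz_div, Derivation.leibniz, hda, hda', ddt_X]
    simp only [smul_eq_mul]
    field_simp
    ring
  have hp2 : RatFunc.X ^ 2 * L.p₂ = φ * (φ + h) - eulerDer ∞ φ := by
    have h5 : RatFunc.X ^ 2 * L.p₂ = -(RatFunc.X ^ 2 * a'' / a) + φ * (RatFunc.X * L.p₁) := by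
      rw [hφ]
      field_simp
      linear_combination h3
    rw [h5, hp1, hθφ]
    ring
  -- The values at `∞` of `1 - 2φ - h` and `φ (φ + h) - θ φ`.
  refine ⟨1 - 2 * -(f.natDegree : k) - α, -(f.natDegree : k) * (-(f.natDegree : k) + α), ?_, ?_, ?_⟩
  · have h5 : localParam ∞ * (L.localCoeffs ∞).1 = 1 - 2 * φ - h := by
      change RatFunc.X⁻¹ * (2 * RatFunc.X - RatFunc.X ^ 2 * L.p₁) = _
      field_simp
      linear_combination -hp1
    rw [h5, two_mul, two_mul]
    exact ((HasValueAt.one ∞).sub (hφv.add hφv)).sub hα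
  · have h5 : localParam ∞ ^ 2 * (L.localCoeffs ∞).2 = φ * (φ + h) - eulerDer ∞ φ := by
      rw [← hp2]
      change RatFunc.X⁻¹ ^ 2 * (RatFunc.X ^ 4 * L.p₂) = _
      field_simp
    rw [h5]
    have h6 := (hφv.mul (hφv.add hα)).sub (eulerDer_hasValueAt hφv.mem)
    rwa [sub_zero] at h6
  · simp only [map_add, map_sub, map_neg, map_mul, map_one, map_ofNat]
    ring

/-! ### The zeros of `γ e₁` and the supersingular points. -/

theorem IsAffineGenerator.mem {e₁ : V} (he : E.IsAffineGenerator F e₁) (a : k) :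
    e₁ ∈ E.stalk (a : OnePoint k) ∧ e₁ ∈ F := by
  have h := Submodule.mem_span_singleton_self (R := localRing (a : OnePoint k)) e₁
  rw [he a] at h
  exact h

theorem IsAffineGenerator.exists_eq_smul {e₁ : V} (he : E.IsAffineGenerator F e₁) (a : k) :
    ∀ y ∈ E.stalk (a : OnePoint k), y ∈ F → ∃ g ∈ localRing (a : OnePoint k), y = g • e₁ := by
  intro y hy hyF
  have h : y ∈ Submodule.span (localRing (a : OnePoint k)) {e₁} := by
    rw [he a]; exact ⟨hy, hyF⟩
  obtain ⟨g, rfl⟩ := Submodule.mem_span_singleton.mp h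
  exact ⟨g, g.2, rfl⟩

theorem exists_logDer_coe_eq (S : Finset (OnePoint k)) (a : k) :
    ∃ q : k[X], logDer S (a : OnePoint k) = algebraMap k[X] (RatFunc k) q • ddt k := by
  unfold logDer
  split_ifs
  · refine ⟨X - C a, ?_⟩
    rw [map_sub, RatFunc.algebraMap_X, RatFunc.algebraMap_C]; rfl
  · exact ⟨1, by rw [map_one, one_smul]; rfl⟩

/-- The value of `γ` on a generator of the Hodge filtration has only simple zeros. -/
theorem IsHodgeFiltration.eval_derivative_ne_zero (hF : E.IsHodgeFiltration F)
    (hγ : E.IsNormalization γ) {e₁ : V} (he : E.IsAffineGenerator F e₁) {u : k[X]}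
    (hu : algebraMap k[X] (RatFunc k) u = γ e₁) {a : k} (ha : u.IsRoot a) :
    (derivative u).eval a ≠ 0 := by
  intro h'
  refine hF.not_both_zero hγ (he.exists_eq_smul a) ?_ ?_
  · rw [← hu, ← ha.eq_zero]; exact hasValueAt_algebraMap a u
  · obtain ⟨q, hq⟩ := exists_logDer_coe_eq S a
    rw [← hu, hq, Derivation.smul_apply, ddt_algebraMap, smul_eq_mul]
    have h := (hasValueAt_algebraMap a q).mul (hasValueAt_algebraMap a (derivative u))
    rwa [h', mul_zero] at h

theorem IsHodgeFiltration.span_affineGenerator (hF : E.IsHodgeFiltration F)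
    (hE : E.IsVectorBundle) {e₁ : V} (he : E.IsAffineGenerator F e₁) :
    Submodule.span (RatFunc k) {e₁, E.nabla (ddt k) e₁} = ⊤ := by
  -- Any finite point would do: only the generic span matters, and the logarithmic field there is a
  -- multiple of `D`.
  obtain ⟨q, hq⟩ := exists_logDer_coe_eq S 0
  rw [eq_top_iff, ← hF.span_eq_top hE (he.exists_eq_smul 0), Submodule.span_le, hq, map_smul]
  rintro _ (rfl | rfl)
  · exact Submodule.subset_span (by simp)
  · exact Submodule.smul_mem _ _ (Submodule.subset_span (by simp))

theorem eval_apply_eq_zero {L : DiffOp k} {e₁ : V}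
    (hL : E.nabla (ddt k) (E.nabla (ddt k) e₁) = -(L.p₂ • e₁) - L.p₁ • E.nabla (ddt k) e₁)
    (hγ : E.IsNormalization γ) : L.eval (γ e₁) = 0 := by
  have h := congrArg γ hL
  simp only [hγ.horizontal, map_sub, map_neg, map_smul, smul_eq_mul] at h
  unfold DiffOp.eval
  linear_combination h

/-- The supersingular points are the zeros of `γ e₁`. -/
theorem supersingular_eq (hF : E.IsHodgeFiltration F) (hγ : E.IsNormalization γ)
    (hinf : (∞ : OnePoint k) ∈ S) {e₁ : V} (he : E.IsAffineGenerator F e₁) {u : k[X]} (hu0 : u ≠ 0)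
    (hu : algebraMap k[X] (RatFunc k) u = γ e₁) :
    E.supersingular F γ = (fun a : k => (a : OnePoint k)) '' {a | u.IsRoot a} := by
  have huK := ratFunc_algebraMap_ne hu0
  have he0 : e₁ ≠ 0 := by rintro rfl; rw [map_zero] at hu; exact huK hu
  have hcan : ∀ e₀, IsCanonicalSection F γ e₀ ↔ e₀ = (algebraMap k[X] (RatFunc k) u)⁻¹ • e₁ := by
    intro e₀
    constructor
    · rintro ⟨h, h'⟩
      obtain ⟨c, rfl⟩ := hF.exists_smul_eq (he.mem 0).2 he0 h
      rw [map_smul, ← hu, smul_eq_mul] at h'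
      rw [eq_inv_of_mul_eq_one_left h']
    · rintro rfl
      exact ⟨F.smul_mem _ (he.mem 0).2, by rw [map_smul, ← hu, smul_eq_mul, inv_mul_cancel₀ huK]⟩
  have hmem : ∀ (a : k) (c : RatFunc k),
      c • e₁ ∈ E.stalk (a : OnePoint k) ↔ c ∈ localRing (a : OnePoint k) := by
    intro a c
    refine ⟨fun h => ?_, fun h => smul_mem_stalk h (he.mem a).1⟩
    obtain ⟨g, hg, hcg⟩ := he.exists_eq_smul a _ h (F.smul_mem _ (he.mem a).2)
    rwa [smul_left_injective (RatFunc k) he0 hcg]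
  ext x
  constructor
  · rintro ⟨e₀, h, hpole⟩
    match x with
    | ∞ =>
      obtain ⟨e, hes, hec⟩ := hF.exists_canonicalSection hγ hinf
      rw [(hcan e₀).mp h, ← (hcan e).mp hec] at hpole
      exact absurd hes hpole.2
    | (a : k) =>
      refine ⟨a, ?_, rfl⟩
      by_contra ha
      apply hpole.2
      rw [(hcan e₀).mp h, hmem]
      exact ((hasValueAt_algebraMap a u).inv ha).mem
  · rintro ⟨a, ha, rfl⟩
    refine ⟨_, (hcan _).mpr rfl, ?_, ?_⟩
    -- The pole of `u⁻¹` is simple because `q(a) = u'(a) ≠ 0`.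
    · obtain ⟨q, hq⟩ := dvd_iff_isRoot.mpr ha
      have hqa : q.eval a ≠ 0 := by
        have := hF.eval_derivative_ne_zero hγ he hu ha
        rw [hq] at this
        simpa using this
      have hq0 : q ≠ 0 := by rintro rfl; simp at hqa
      rw [smul_smul, hmem]
      have h : localParam (a : OnePoint k) * (algebraMap k[X] (RatFunc k) u)⁻¹ =
          (algebraMap k[X] (RatFunc k) q)⁻¹ := by
        have hl : algebraMap k[X] (RatFunc k) (X - C a) = localParam (a : OnePoint k) := by
          rw [map_sub, RatFunc.algebraMap_X, RatFunc.algebraMap_C]; rfl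
        have hl0 := localParam_ne_zero (a : OnePoint k)
        rw [hq, map_mul, hl, mul_inv, mul_inv_cancel_left₀ hl0]
      rw [h]
      exact ((hasValueAt_algebraMap a q).inv hqa).mem
    · rw [hmem]
      intro h
      obtain ⟨c, hc⟩ := exists_hasValueAt h
      have h1 := hc.mul (hasValueAt_algebraMap a u)
      rw [inv_mul_cancel₀ huK, ha.eq_zero, mul_zero] at h1
      exact zero_ne_one (h1.unique (HasValueAt.one _))

end LogConnection

end P1Indigenous

end

/-! ### The proposition. -/

open P1Indigenous P1Indigenous.LogConnection in
theorem proposition5p1 {k : Type*} [Field k] [IsAlgClosed k]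
    (p : ℕ) [Fact p.Prime] [CharP k p] (hp : p ≠ 2)
    {V : Type*} [AddCommGroup V] [Module (RatFunc k) V] [Module k V]
    [IsScalarTower k (RatFunc k) V]
    (S : Finset (OnePoint k)) (hS : 3 ≤ S.card) (hinf : (∞ : OnePoint k) ∈ S)
    (E : P1Indigenous.LogConnection S V) (hE : E.IsIndigenous)
    (hactive : E.IsActive p) (hnilp : E.IsNilpotentCurv p)
    (F : Submodule (RatFunc k) V) (hF : E.IsHodgeFiltration F)
    (γ : V →ₗ[RatFunc k] RatFunc k) (hγ : E.IsNormalization γ)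
    (L : P1Indigenous.DiffOp k) (hL : E.IsAssociated F L) :
    (∃ u : k[X], u ≠ 0 ∧ L.eval (algebraMap k[X] (RatFunc k) u) = 0 ∧
      (∀ a : k, u.IsRoot a → u.rootMultiplicity a = 1) ∧
      ((fun a : k => (a : OnePoint k)) '' {a | u.IsRoot a} = E.supersingular F γ) ∧
      ∀ v : k[X], v ≠ 0 → L.eval (algebraMap k[X] (RatFunc k) v) = 0 →
        (∀ a : k, v.IsRoot a → v.rootMultiplicity a = 1) →
        ∃ c : k, c ≠ 0 ∧ v = C c * u) ∧
    ∃ α : k, α ^ p = α ∧ (∀ β : k, hγ.kernel.IsLocalExponent ∞ β ↔ β = α) ∧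
      L.HasLocalExponents ∞ (-((E.supersingular F γ).ncard : k) + α)
        (-((E.supersingular F γ).ncard : k)) := by
  obtain ⟨e₁, he, hL⟩ := hL
  have hspan := hF.span_affineGenerator hE.bundle he
  have hind := linearIndependent_of_span_pair hE.rank_two hspan
  obtain ⟨u, hu⟩ := exists_algebraMap_eq fun a => hγ.map_mem (he.mem a).1
  have hu0 : u ≠ 0 := by
    -- The zero polynomial would vanish at `0` together with its derivative.
    rintro rfl
    exact hF.eval_derivative_ne_zero hγ he hu (a := 0) (by simp) (by simp)
  have huL : L.eval (algebraMap k[X] (RatFunc k) u) = 0 := hu ▸ eval_apply_eq_zero hL hγ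
  have hder : ∀ a, u.IsRoot a → (derivative u).eval a ≠ 0 := fun a ha =>
    hF.eval_derivative_ne_zero hγ he hu ha
  have hsimple : ∀ a, u.IsRoot a → u.rootMultiplicity a = 1 := by
    intro a ha
    have h1 := (rootMultiplicity_pos hu0).mpr ha
    have h2 := mt (one_lt_rootMultiplicity_iff_isRoot hu0).mp fun h => hder a ha h.2
    omega
  have hss := supersingular_eq hF hγ hinf he hu0 hu
  have hcard : (E.supersingular F γ).ncard = u.natDegree := by
    have hinj : Function.Injective (fun a : k => (a : OnePoint k)) := OnePoint.coe_injective
    classical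
    have hset : {a | u.IsRoot a} = (u.roots.toFinset : Set k) := by
      ext a; simp [hu0]
    rw [hss, Set.ncard_image_of_injective _ hinj, hset, Set.ncard_coe_finset,
      ← splits_iff_card_roots.mp (IsAlgClosed.splits u)]
    apply Multiset.toFinset_card_of_nodup
    rw [Multiset.nodup_iff_count_le_one]
    intro a
    rw [count_roots]
    by_cases ha : u.IsRoot a
    · exact (hsimple a ha).le
    · rw [rootMultiplicity_eq_zero ha]; exact zero_le_one
  refine ⟨⟨u, hu0, huL, hsimple, hss.symm, fun v hv0 hv hv1 => ?_⟩, ?_⟩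
  · refine exists_eq_C_mul hu0 hv0 hsimple hv1 ?_
    have hW := wronskian_eq_zero p hactive hind hspan hL huL hv
    rw [ddt_algebraMap, ddt_algebraMap, ← map_mul, ← map_mul, ← map_sub] at hW
    exact RatFunc.algebraMap_injective k (hW.trans (map_zero _).symm)
  · obtain ⟨e₀, hes, heF, hγe⟩ := hF.exists_canonicalSection hγ hinf
    have he0 : e₀ ≠ 0 := by rintro rfl; simp at hγe
    have hlog : logDer S ∞ = eulerDer (∞ : OnePoint k) := if_pos hinf
    have hgen : ∀ y ∈ E.stalk ∞, y ∈ F → ∃ g ∈ localRing (∞ : OnePoint k), y = g • e₀ := by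
      intro y hy hyF
      obtain ⟨c, rfl⟩ := hF.exists_smul_eq heF he0 hyF
      have hc := hγ.map_mem hy
      rw [map_smul, hγe, smul_eq_mul, mul_one] at hc
      exact ⟨c, hc, rfl⟩
    set w := E.nabla (eulerDer ∞) e₀ with hw
    have hws : w ∈ E.stalk ∞ := E.euler_mem ∞ e₀ hes
    have hγw : γ w = 0 := by rw [hw, hγ.horizontal, hγe, Derivation.map_one_eq_zero]
    -- Since `γ e₀ = 1` and `γ w = 0`, the coefficient of `e₀` in `y` is `γ y`.
    have hgenw : ∀ y ∈ E.stalk ∞, γ y = 0 → ∃ g ∈ localRing (∞ : OnePoint k), y = g • w := by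
      intro y hy hγy
      obtain ⟨g, -, g', hg', rfl⟩ := hF.exists_coeffs hgen hy
      rw [hlog] at hγy ⊢
      rw [map_add, map_smul, map_smul, hγw, hγe, smul_zero, add_zero, smul_eq_mul, mul_one] at hγy
      exact ⟨g', hg', by rw [hγy, zero_smul, zero_add]⟩
    have hspan' := hF.span_eq_top hE.bundle hgen
    rw [hlog, ← hw] at hspan'
    have hind' := linearIndependent_of_span_pair hE.rank_two hspan'
    have hw0 : w ≠ 0 := hind'.ne_zero 1
    obtain ⟨h, hh, hhw⟩ := hgenw _ (E.euler_mem ∞ w hws) (by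
      rw [hγ.horizontal, hγw, map_zero])
    obtain ⟨α, hα⟩ := exists_hasValueAt hh
    refine ⟨α, hnilp.pow_eq_self p hp hw0 hhw hα,
      hγ.kernel_isLocalExponent_iff hw0 hws hγw hgenw hhw hα, ?_⟩
    have he₁ : e₁ = algebraMap k[X] (RatFunc k) u • e₀ := by
      obtain ⟨c, hc⟩ := hF.exists_smul_eq heF he0 (he.mem 0).2
      rw [hu, hc, map_smul, hγe, smul_eq_mul, mul_one]
    rw [hcard]
    rw [he₁] at hL
    exact hasLocalExponents_infty hu0 hα hind' hw.symm hhw hL
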